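/- Let $\mathcal R$ be a term rewrite system (TRS): a set of rewrite rules $l\to r$, i.e. pairs of terms over a signature and a set of variables, with no variable condition imposed. A rule is duplicating if some variable occurs more often in $r$ than in $l$; let $\mathcal R_{\mathsf d}$ and $\mathcal R_{\mathsf{nd}}$ be the sets of duplicating and non-duplicating rules of $\mathcal R$. Write $s\to^\pi t$ for a rewrite step of $\mathcal R$ with redex pattern $\pi=\langle p,\,l\to r,\,\tau\rangle$ (so $s|_p=l\tau$ and $t=s[r\tau]_p$); for a context $C$ with hole at position $q$ and a substitution $\sigma$ let $C[\pi\sigma]=\langle qp,\,l\to r,\,\tau\sigma\rangle$. Let $>$ and $\geqslant$ be relations on a set of labels, and let $\ell$ assign a label to every rewrite step, read forwards ($s\to^\pi t$) or backwards ($t\leftarrow^\pi s$). * $\ell$ is a *labeling* (for $>,\geqslant$) if $\ell(s\to^\pi t)=\ell(t\leftarrow^\pi s)$ always, and for all contexts $C$ and substitutions $\sigma$ and both choices of $\mathrel{\rhd}\in\{>,\geqslant\}$: $\ell(s\to^{\pi_1}t)\rhd\ell(u\to^{\pi_2}v)$ implies $\ell(C[s\sigma]\to^{C[\pi_1\sigma]}C[t\sigma])\rhd\ell(C[u\sigma]\to^{C[\pi_2\sigma]}C[v\sigma])$.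 * Consider a local peak $t\leftarrow^{\pi_1}s\to^{\pi_2}u$ with redex positions $p$ (of $\pi_1$) and $q$ (of $\pi_2$), rule $l_2\to r_2$ of $\pi_2$, and labels $\alpha=\ell(t\leftarrow^{\pi_1}s)$, $\beta=\ell(s\to^{\pi_2}u)$. It is a *parallel peak* if $p$ and $q$ are incomparable in the prefix order, and a *variable peak* if $p=qq'$ where $q'$ is not a function symbol position of $l_2$. * The peak is *extended locally decreasing* for $\ell$ if there are terms $t',t'',u'',u'$ with $t\leftrightarrow^* t'\to^= t''\leftrightarrow^* u''\mathrel{{}^={\leftarrow}}u'\leftrightarrow^* u$ in which the labels of the five parts are, respectively, $<\alpha$; $\leqslant\beta$; $<\alpha$ or $<\beta$; $\leqslant\alpha$; $<\beta$ (where $\to^=$ is at most one step, and $x<y$, $x\leqslant y$ mean $y>x$, $y\geqslant x$). * The peak is *weakly extended locally decreasing* for $\ell$ if there are a term $v$, a step $t\to v$ with label $\leqslant\beta$, and $n\ge 0$ steps $u\to^n v$ with labels $\leqslant\alpha$ (of these steps read backwards), where $n\leqslant 1$ if $r_2$ is linear. * $\ell$ is *compatible* (resp. *weakly compatible*) with $\mathcal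 R$ if all parallel peaks and all variable peaks of $\mathcal R$ are extended locally decreasing (resp. weakly extended locally decreasing) for $\ell$. The *source labeling* $\ell^{\mathsf{src}}$ labels a step $s\to^\pi t$ (in either reading) by its source $s$; its labels are compared by $>_{\mathsf{src}}\,:=\,\to^+_{\mathcal R_{\mathsf d}/\mathcal R_{\mathsf{nd}}}$ and $\geqslant_{\mathsf{src}}\,:=\,\to^*_{\mathcal R}$, where $\to_{\mathcal R_{\mathsf d}/\mathcal R_{\mathsf{nd}}}\,=\,\to^*_{\mathcal R_{\mathsf{nd}}}\cdot\to_{\mathcal R_{\mathsf d}}\cdot\to^*_{\mathcal R_{\mathsf{nd}}}$. The *lexicographic combination* $\ell^{\mathsf{src}}\times\ell$ labels a step by the pair of its two labels; pairs are compared by $$(a,b)>_{\mathsf{lex}}(a',b')\iff a>_{\mathsf{src}}a'\ \text{ or }\ (a\geqslant_{\mathsf{src}}a'\text{ and }b>b'),$$ $$(a,b)\geqslant_{\mathsf{lex}}(a',b')\iff a>_{\mathsf{src}}a'\ \text{ or }\ (a\geqslant_{\mathsf{src}}a'\text{ and }b\geqslant b').$$ **Lemma.** Let $\mathcal R$ be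 a left-linear TRS whose duplicating rules terminate relative to its other rules (that is, $\to_{\mathcal R_{\mathsf d}/\mathcal R_{\mathsf{nd}}}$ admits no infinite sequence), and let $\ell$ be a labeling for $>,\geqslant$ that is weakly compatible with $\mathcal R$. Then 1. $\ell^{\mathsf{src}}\times\ell$ is a labeling for $>_{\mathsf{lex}},\geqslant_{\mathsf{lex}}$; 2. $\ell^{\mathsf{src}}\times\ell$ is compatible with $\mathcal R$ for $>_{\mathsf{lex}},\geqslant_{\mathsf{lex}}$; 3. the required properties of the orders are preserved: if $>$ is a well-founded order, $\geqslant$ is a preorder, and ${\geqslant}\cdot{>}\cdot{\geqslant}\subseteq{>}$, then the same holds for $>_{\mathsf{lex}}$ and $\geqslant_{\mathsf{lex}}$. -/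

import Mathlib

universe u v w z

namespace TRS

/-! Terms over a signature `L` (only the function symbols of `L` matter) and a type `V` of
variables are Mathlib's `L.Term V`; substitutions are functions `V → L.Term V`, applied with
`FirstOrder.Language.Term.subst`. -/

variable {L : FirstOrder.Language.{u, v}} {V : Type w}

/-- A position is a list of argument indices, where the arguments of a function symbol of arity
`n` are numbered `0, …, n - 1`. -/
abbrev Position := List ℕ

/-- Two positions are parallel if neither is a prefix of the other. -/
def ParallelPos (p q : Position) : Prop := ¬ p <+: q ∧ ¬ q <+: p

/-- The subterm of a term at a position; `none` if it is not a position of the term. -/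
def subtermAt : L.Term V → Position → Option (L.Term V)
  | t, [] => some t
  | .var _, _ :: _ => none
  | .func (l := n) _ ts, i :: p => if h : i < n then subtermAt (ts ⟨i, h⟩) p else none

/-- The term `s[u]_p`, for a position `p` of `s` (and `s` itself if `p` is not one). -/
def replaceAt : L.Term V → Position → L.Term V → L.Term V
  | _, [], u => u
  | .var x, _ :: _, _ => .var x
  | .func f ts, i :: p, u =>
      .func f (fun j => if (j : ℕ) = i then replaceAt (ts j) p u else ts j)

/-- The set of function symbol positions of a term. -/
def funPos (t : L.Term V) : Set Position :=
  {p | ∃ (n : ℕ) (f : L.Functions n) (ts : Fin n → L.Term V), subtermAt t p = some (.func f ts)}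

open Classical in
/-- The number `|t|_x` of occurrences of the variable `x` in the term `t`. -/
noncomputable def occ (x : V) : L.Term V → ℕ
  | .var y => if y = x then 1 else 0
  | .func _ ts => ∑ i, occ x (ts i)

/-- A term is linear if every variable occurs at most once in it. -/
def LinearTerm (t : L.Term V) : Prop := ∀ x, occ x t ≤ 1

/-- Contexts: terms with exactly one hole. -/
inductive Context (L : FirstOrder.Language.{u, v}) (V : Type w) : Type (max u v w)
  | hole : Context L V
  | app {n : ℕ} (f : L.Functions n) (i : Fin n) (C : Context L V)
      (ts : {j : Fin n // j ≠ i} → L.Term V) : Context L V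

/-- The term `C[t]`. -/
def Context.fill : Context L V → L.Term V → L.Term V
  | .hole, t => t
  | .app f i C ts, t => .func f (fun j => if h : j = i then C.fill t else ts ⟨j, h⟩)

/-- The position of the hole of a context. -/
def Context.holePos : Context L V → Position
  | .hole => []
  | .app _ i C _ => (i : ℕ) :: C.holePos

/-- A rewrite rule is a pair of terms (without any variable condition). -/
structure Rule (L : FirstOrder.Language.{u, v}) (V : Type w) where
  lhs : L.Term V
  rhs : L.Term V

/-- A rule is duplicating if some variable occurs more often on the right than on the left. -/
def Rule.Duplicating (ρ : Rule L V) : Prop := ∃ x, occ x ρ.lhs < occ x ρ.rhs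

/-- A term rewrite system over the signature `L`. -/
abbrev System (L : FirstOrder.Language.{u, v}) (V : Type w) := Set (Rule L V)

def LeftLinear (R : System L V) : Prop := ∀ ρ ∈ R, LinearTerm ρ.lhs

/-- The duplicating rules of `R`. -/
def dupRules (R : System L V) : System L V := {ρ ∈ R | ρ.Duplicating}

/-- The non-duplicating rules of `R`. -/
def nonDupRules (R : System L V) : System L V := {ρ ∈ R | ¬ ρ.Duplicating}

/-- Redex patterns `⟨p, l → r, σ⟩`. -/
structure Redex (L : FirstOrder.Language.{u, v}) (V : Type w) where
  pos : Position
  rule : Rule L V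
  sub : V → L.Term V

/-- The redex pattern `C[πσ] = ⟨qp, l → r, τσ⟩`, where `π = ⟨p, l → r, τ⟩` and `q` is the
position of the hole of `C`. -/
def Redex.lift (C : Context L V) (σ : V → L.Term V) (π : Redex L V) : Redex L V where
  pos := C.holePos ++ π.pos
  rule := π.rule
  sub := fun x => (π.sub x).subst σ

/-- `s →^π t` in the system `R`. -/
def IsStep (R : System L V) (s : L.Term V) (π : Redex L V) (t : L.Term V) : Prop :=
  π.rule ∈ R ∧ subtermAt s π.pos = some (π.rule.lhs.subst π.sub) ∧
    t = replaceAt s π.pos (π.rule.rhs.subst π.sub)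

/-- The rewrite relation `→_R`. -/
def Rewrites (R : System L V) (s t : L.Term V) : Prop := ∃ π, IsStep R s π t

/-- The relative rewrite relation `→_{R/S} = →_S^* · →_R · →_S^*`. -/
def RelRewrites (R S : System L V) (s t : L.Term V) : Prop :=
  ∃ s' t', Relation.ReflTransGen (Rewrites S) s s' ∧ Rewrites R s' t' ∧
    Relation.ReflTransGen (Rewrites S) t' t

/-- `R` terminates relative to `S`: there is no infinite sequence `s₀ →_{R/S} s₁ →_{R/S} ⋯`. -/
def RelTerminating (R S : System L V) : Prop := WellFounded (fun t s => RelRewrites R S s t)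

/-! Rewrite steps are closed under contexts and substitutions. -/

theorem subst_subst (t : L.Term V) (σ τ : V → L.Term V) :
    (t.subst σ).subst τ = t.subst (fun x => (σ x).subst τ) := by
  induction t with
  | var x => rfl
  | func f ts ih => simp only [FirstOrder.Language.Term.subst, ih]

theorem subtermAt_subst (σ : V → L.Term V) (p : Position) : ∀ (t u : L.Term V),
    subtermAt t p = some u → subtermAt (t.subst σ) p = some (u.subst σ) := by
  induction p with
  | nil => intro t u h; simp_all [subtermAt]
  | cons i p ih =>
    intro t u h
    cases t with
    | var x => simp [subtermAt] at h
    | @func n f ts =>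
      by_cases hi : i < n
      · simp only [subtermAt, hi, dite_true, FirstOrder.Language.Term.subst] at h ⊢
        exact ih _ _ h
      · simp [subtermAt, hi] at h

theorem replaceAt_subst (σ : V → L.Term V) (w : L.Term V) (p : Position) : ∀ (t u : L.Term V),
    subtermAt t p = some u →
      (replaceAt t p w).subst σ = replaceAt (t.subst σ) p (w.subst σ) := by
  induction p with
  | nil => intro t u _; simp [replaceAt]
  | cons i p ih =>
    intro t u h
    cases t with
    | var x => simp [subtermAt] at h
    | @func n f ts =>
      by_cases hi : i < n
      · simp only [subtermAt, hi, dite_true] at h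
        simp only [replaceAt, FirstOrder.Language.Term.subst]
        congr 1
        funext j
        by_cases hj : (j : ℕ) = i
        · subst hj
          simp only [if_true]
          exact ih _ _ h
        · simp [hj]
      · simp [subtermAt, hi] at h

theorem subtermAt_fill (C : Context L V) (t : L.Term V) (p : Position) :
    subtermAt (C.fill t) (C.holePos ++ p) = subtermAt t p := by
  induction C with
  | hole => rfl
  | app f i C ts ih => simp [Context.fill, Context.holePos, subtermAt, ih]

theorem replaceAt_fill (C : Context L V) (t w : L.Term V) (p : Position) :
    replaceAt (C.fill t) (C.holePos ++ p) w = C.fill (replaceAt t p w) := by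
  induction C with
  | hole => rfl
  | app f i C ts ih =>
    simp only [Context.fill, Context.holePos, List.cons_append, replaceAt]
    congr 1
    funext j
    by_cases hj : j = i
    · subst hj; simp [ih]
    · simp [hj, Fin.val_inj]

theorem IsStep.lift {R : System L V} {s t : L.Term V} {π : Redex L V} (h : IsStep R s π t)
    (C : Context L V) (σ : V → L.Term V) :
    IsStep R (C.fill (s.subst σ)) (π.lift C σ) (C.fill (t.subst σ)) := by
  obtain ⟨h1, h2, h3⟩ := h
  refine ⟨h1, ?_, ?_⟩
  · simp only [Redex.lift]
    rw [subtermAt_fill, subtermAt_subst σ _ _ _ h2, subst_subst]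
  · simp only [Redex.lift]
    rw [replaceAt_fill, h3, replaceAt_subst σ _ _ _ _ h2, subst_subst]

/-! Rewrite steps with full information, conversions, labelings. -/

/-- A rewrite step `s →^π t` of `R`. -/
structure Step (R : System L V) where
  source : L.Term V
  redex : Redex L V
  target : L.Term V
  isStep : IsStep R source redex target

/-- The rewrite step `C[sσ] →^{C[πσ]} C[tσ]` obtained from the rewrite step `s →^π t`. -/
def Step.lift {R : System L V} (C : Context L V) (σ : V → L.Term V) (a : Step R) : Step R where
  source := C.fill (a.source.subst σ)
  redex := a.redex.lift C σ
  target := C.fill (a.target.subst σ)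
  isStep := a.isStep.lift C σ

/-- A rewrite step together with the direction in which it is read. -/
inductive DirStep (R : System L V)
  /-- `s →^π t` -/
  | fwd (a : Step R) : DirStep R
  /-- `t ←^π s` -/
  | bwd (a : Step R) : DirStep R

/-- The underlying rewrite step. -/
def DirStep.step {R : System L V} : DirStep R → Step R
  | .fwd a => a
  | .bwd a => a

/-- The term on the left: `s` for `s →^π t`, and `t` for `t ←^π s`. -/
def DirStep.first {R : System L V} : DirStep R → L.Term V
  | .fwd a => a.source
  | .bwd a => a.target

/-- The term on the right: `t` for `s →^π t`, and `s` for `t ←^π s`. -/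
def DirStep.last {R : System L V} : DirStep R → L.Term V
  | .fwd a => a.target
  | .bwd a => a.source

def DirStep.IsFwd {R : System L V} (d : DirStep R) : Prop := ∃ a, d = .fwd a

def DirStep.IsBwd {R : System L V} (d : DirStep R) : Prop := ∃ a, d = .bwd a

/-- `ds` is a conversion from `s` to `t`. -/
def IsConversion {R : System L V} : L.Term V → List (DirStep R) → L.Term V → Prop
  | s, [], t => s = t
  | s, d :: ds, t => d.first = s ∧ IsConversion d.last ds t

/-- The set of labels of a conversion. -/
def labels {R : System L V} {A : Type z} (ℓ : DirStep R → A) (ds : List (DirStep R)) : Set A :=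
  {α | ∃ d ∈ ds, ℓ d = α}

/-- The set of all `β` that are below some element of `S`. -/
def below {A : Type z} (r : A → A → Prop) (S : Set A) : Set A := {β | ∃ α ∈ S, r α β}

/-- `ℓ` is a labeling, with respect to the relations `gt` and `ge` that compare labels. -/
structure IsLabeling {R : System L V} {A : Type z} (gt ge : A → A → Prop)
    (ℓ : DirStep R → A) : Prop where
  gt_lift : ∀ (a b : Step R) (C : Context L V) (σ : V → L.Term V),
    gt (ℓ (.fwd a)) (ℓ (.fwd b)) → gt (ℓ (.fwd (a.lift C σ))) (ℓ (.fwd (b.lift C σ)))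
  ge_lift : ∀ (a b : Step R) (C : Context L V) (σ : V → L.Term V),
    ge (ℓ (.fwd a)) (ℓ (.fwd b)) → ge (ℓ (.fwd (a.lift C σ))) (ℓ (.fwd (b.lift C σ)))
  fwd_eq_bwd : ∀ a : Step R, ℓ (.fwd a) = ℓ (.bwd a)

/-- The steps `a : s → t` and `b : s → u` form a local peak `t ← s → u`. -/
def IsPeak {R : System L V} (a b : Step R) : Prop := a.source = b.source

/-- A local peak with parallel redex positions. -/
def IsParallelPeak {R : System L V} (a b : Step R) : Prop :=
  IsPeak a b ∧ ParallelPos a.redex.pos b.redex.pos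

/-- A local peak in which the redex of `a` is at or below a variable position of the left-hand
side of the rule applied in `b`. -/
def IsVariablePeak {R : System L V} (a b : Step R) : Prop :=
  IsPeak a b ∧ ∃ q' : Position,
    b.redex.pos ++ q' = a.redex.pos ∧ q' ∉ funPos b.redex.rule.lhs

/-- The local peak `t ← s → u` of `a : s → t` and `b : s → u` is extended locally decreasing:
there is `t ↔* t' →⁼ t'' ↔* u'' ⁼← u' ↔* u` with suitably small labels. -/
def ExtLocallyDecreasing {R : System L V} {A : Type z} (gt ge : A → A → Prop)
    (ℓ : DirStep R → A) (a b : Step R) : Prop :=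
  ∃ (t' t'' u'' u' : L.Term V) (c₁ d₁ c₂ d₂ c₃ : List (DirStep R)),
    (IsConversion a.target c₁ t' ∧ labels ℓ c₁ ⊆ below gt {ℓ (.bwd a)}) ∧
    (IsConversion t' d₁ t'' ∧ d₁.length ≤ 1 ∧ (∀ d ∈ d₁, d.IsFwd) ∧
      labels ℓ d₁ ⊆ below ge {ℓ (.fwd b)}) ∧
    (IsConversion t'' c₂ u'' ∧ labels ℓ c₂ ⊆ below gt {ℓ (.bwd a), ℓ (.fwd b)}) ∧
    (IsConversion u'' d₂ u' ∧ d₂.length ≤ 1 ∧ (∀ d ∈ d₂, d.IsBwd) ∧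
      labels ℓ d₂ ⊆ below ge {ℓ (.bwd a)}) ∧
    (IsConversion u' c₃ b.target ∧ labels ℓ c₃ ⊆ below gt {ℓ (.fwd b)})

/-- `ℓ` is compatible with `R`. -/
def IsCompatible {R : System L V} {A : Type z} (gt ge : A → A → Prop)
    (ℓ : DirStep R → A) : Prop :=
  ∀ a b : Step R, IsParallelPeak a b ∨ IsVariablePeak a b → ExtLocallyDecreasing gt ge ℓ a b

/-- The local peak `t ← s → u` of `a : s → t` and `b : s → u` is weakly extended locally
decreasing: there is `t → v ⁿ← u`, where the label of `t → v` is at most that of `b`, the labels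
of `v ⁿ← u` are at most that of `a`, and `n ≤ 1` if the right-hand side of the rule applied in
`b` is linear. -/
def WeakExtLocallyDecreasing {R : System L V} {A : Type z} (ge : A → A → Prop)
    (ℓ : DirStep R → A) (a b : Step R) : Prop :=
  ∃ (c : Step R) (ds : List (DirStep R)),
    c.source = a.target ∧ ℓ (.fwd c) ∈ below ge {ℓ (.fwd b)} ∧
    IsConversion c.target ds b.target ∧ (∀ d ∈ ds, d.IsBwd) ∧
    labels ℓ ds ⊆ below ge {ℓ (.bwd a)} ∧
    (LinearTerm b.redex.rule.rhs → ds.length ≤ 1)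

/-- `ℓ` is weakly compatible with `R`. -/
def IsWeaklyCompatible {R : System L V} {A : Type z} (ge : A → A → Prop)
    (ℓ : DirStep R → A) : Prop :=
  ∀ a b : Step R, IsParallelPeak a b ∨ IsVariablePeak a b → WeakExtLocallyDecreasing ge ℓ a b

/-- `gt` is a well-founded order, `ge` is a preorder, and the two are compatible, that is,
`ge · gt · ge ⊆ gt`. -/
structure IsOrderPair {A : Type z} (gt ge : A → A → Prop) : Prop where
  wf : WellFounded (fun β α => gt α β)
  gt_trans : ∀ α β γ, gt α β → gt β γ → gt α γ
  ge_refl : ∀ α, ge α α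
  ge_trans : ∀ α β γ, ge α β → ge β γ → ge α γ
  compat : ∀ α β γ δ, ge α β → gt β γ → ge γ δ → gt α δ

/-- The source labeling. -/
def srcLabeling (R : System L V) (d : DirStep R) : L.Term V := d.step.source

/-- The strict relation of the source labeling: `→_{R_d/R_nd}^+`. -/
def srcGt (R : System L V) : L.Term V → L.Term V → Prop :=
  Relation.TransGen (RelRewrites (dupRules R) (nonDupRules R))

/-- The weak relation of the source labeling: `→_R^*`. -/
def srcGe (R : System L V) : L.Term V → L.Term V → Prop := Relation.ReflTransGen (Rewrites R)

/-- The strict part of the lexicographic combination of `(gt₁, ge₁)` and `(gt₂, ge₂)`. -/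
def lexGt {A B : Type*} (gt₁ ge₁ : A → A → Prop) (gt₂ : B → B → Prop) (α β : A × B) : Prop :=
  gt₁ α.1 β.1 ∨ (ge₁ α.1 β.1 ∧ gt₂ α.2 β.2)

/-- The weak part of the lexicographic combination of `(gt₁, ge₁)` and `(gt₂, ge₂)`. -/
def lexGe {A B : Type*} (gt₁ ge₁ : A → A → Prop) (ge₂ : B → B → Prop) (α β : A × B) : Prop :=
  gt₁ α.1 β.1 ∨ (ge₁ α.1 β.1 ∧ ge₂ α.2 β.2)

/-- The labeling `ℓ^src × ℓ`. -/
def srcLex {R : System L V} {A : Type z} (ℓ : DirStep R → A) (d : DirStep R) : L.Term V × A :=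
  (srcLabeling R d, ℓ d)

end TRS

/-!
A step `a : s → t` with a duplicating rule strictly decreases the source label. In a left-linear
system every rule with a nonlinear right-hand side is duplicating, so a peak `t ← s → u` whose
weakly decreasing valley `t → v ⁿ← u` has `n > 1` satisfies `s >_src u`: all `n` steps start in
reducts of `u`, so their labels are strictly below that of `s → u`. If `n ≤ 1`, the valley is
already of the required shape, because sources weakly decrease along it.
-/

namespace TRS

open Relation

section RewriteRelation

variable {L : FirstOrder.Language.{u, v}} {V : Type w}

/-- A rewrite relation is a relation on terms that is closed under contexts and substitutions,
which are applied simultaneously here, as in `Step.lift`. -/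
def IsRewriteRelation (r : L.Term V → L.Term V → Prop) : Prop :=
  ∀ (C : Context L V) (σ : V → L.Term V) (s t : L.Term V),
    r s t → r (C.fill (s.subst σ)) (C.fill (t.subst σ))

variable {r : L.Term V → L.Term V → Prop}

theorem IsRewriteRelation.transGen (hr : IsRewriteRelation r) : IsRewriteRelation (TransGen r) :=
  fun C σ _ _ h => h.lift (fun s => C.fill (s.subst σ)) (hr C σ)

theorem IsRewriteRelation.reflTransGen (hr : IsRewriteRelation r) :
    IsRewriteRelation (ReflTransGen r) :=
  fun C σ _ _ h => h.lift (fun s => C.fill (s.subst σ)) (hr C σ)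

theorem isRewriteRelation_rewrites (R : System L V) : IsRewriteRelation (Rewrites R) :=
  fun C σ _ _ ⟨π, hπ⟩ => ⟨π.lift C σ, hπ.lift C σ⟩

theorem isRewriteRelation_relRewrites (R S : System L V) : IsRewriteRelation (RelRewrites R S) :=
  fun C σ s t ⟨s', t', hs, hst, ht⟩ =>
    have hS := (isRewriteRelation_rewrites S).reflTransGen C σ
    ⟨_, _, hS s s' hs, isRewriteRelation_rewrites R C σ s' t' hst, hS t' t ht⟩

theorem isRewriteRelation_srcGt (R : System L V) : IsRewriteRelation (srcGt R) :=
  (isRewriteRelation_relRewrites _ _).transGen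

theorem isRewriteRelation_srcGe (R : System L V) : IsRewriteRelation (srcGe R) :=
  (isRewriteRelation_rewrites R).reflTransGen

end RewriteRelation

section RelativeRewriting

variable {L : FirstOrder.Language.{u, v}} {V : Type w} {R S : System L V} {s t u : L.Term V}

theorem rewrites_union : Rewrites (R ∪ S) s t ↔ Rewrites R s t ∨ Rewrites S s t := by
  simp only [Rewrites, IsStep, Set.mem_union, or_and_right, exists_or]

theorem Rewrites.relRewrites (h : Rewrites R s t) : RelRewrites R S s t :=
  ⟨s, t, .refl, h, .refl⟩

theorem RelRewrites.head (h : Rewrites S s t) (h' : RelRewrites R S t u) : RelRewrites R S s u :=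
  let ⟨t', u', ht, htu, hu⟩ := h'
  ⟨t', u', ht.head h, htu, hu⟩

theorem RelRewrites.tail (h : RelRewrites R S s t) (h' : Rewrites S t u) : RelRewrites R S s u :=
  let ⟨s', t', hs, hst, ht⟩ := h
  ⟨s', t', hs, hst, ht.tail h'⟩

theorem transGen_relRewrites_of_rewrites_left (h : Rewrites (R ∪ S) s t)
    (h' : TransGen (RelRewrites R S) t u) : TransGen (RelRewrites R S) s u := by
  rcases rewrites_union.1 h with hR | hS
  · exact h'.head hR.relRewrites
  · obtain ⟨v, htv, hvu⟩ := TransGen.head'_iff.1 h'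
    exact .head' (htv.head hS) hvu

theorem transGen_relRewrites_of_rewrites_right (h : TransGen (RelRewrites R S) s t)
    (h' : Rewrites (R ∪ S) t u) : TransGen (RelRewrites R S) s u := by
  rcases rewrites_union.1 h' with hR | hS
  · exact h.tail hR.relRewrites
  · obtain ⟨v, hsv, hvt⟩ := TransGen.tail'_iff.1 h
    exact .tail' hsv (hvt.tail hS)

theorem transGen_relRewrites_of_reflTransGen_left (h : ReflTransGen (Rewrites (R ∪ S)) s t)
    (h' : TransGen (RelRewrites R S) t u) : TransGen (RelRewrites R S) s u := by
  induction h using ReflTransGen.head_induction_on with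
  | refl => exact h'
  | head hstep _ ih => exact transGen_relRewrites_of_rewrites_left hstep ih

theorem transGen_relRewrites_of_reflTransGen_right (h : TransGen (RelRewrites R S) s t)
    (h' : ReflTransGen (Rewrites (R ∪ S)) t u) : TransGen (RelRewrites R S) s u := by
  induction h' with
  | refl => exact h
  | tail _ hstep ih => exact transGen_relRewrites_of_rewrites_right ih hstep

theorem RelTerminating.isOrderPair (h : RelTerminating R S) :
    IsOrderPair (TransGen (RelRewrites R S)) (ReflTransGen (Rewrites (R ∪ S))) where
  wf := Subrelation.wf transGen_swap.1 (WellFounded.transGen h)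
  gt_trans _ _ _ := .trans
  ge_refl _ := .refl
  ge_trans _ _ _ := .trans
  compat _ _ _ _ h₁ h₂ h₃ := transGen_relRewrites_of_reflTransGen_right
    (transGen_relRewrites_of_reflTransGen_left h₁ h₂) h₃

end RelativeRewriting

section LexicographicOrder

variable {A B : Type*} {gt₁ ge₁ : A → A → Prop}

theorem IsOrderPair.gt_of_ge_of_gt (h : IsOrderPair gt₁ ge₁) {α β γ : A} (hαβ : ge₁ α β)
    (hβγ : gt₁ β γ) : gt₁ α γ :=
  h.compat _ _ _ _ hαβ hβγ (h.ge_refl γ)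

theorem IsOrderPair.gt_of_gt_of_ge (h : IsOrderPair gt₁ ge₁) {α β γ : A} (hαβ : gt₁ α β)
    (hβγ : ge₁ β γ) : gt₁ α γ :=
  h.compat _ _ _ _ (h.ge_refl α) hαβ hβγ

theorem wellFounded_lexGt {gt₂ : B → B → Prop} (wf₁ : WellFounded fun a' a => gt₁ a a')
    (wf₂ : WellFounded fun b' b => gt₂ b b')
    (gt_of_ge_of_gt : ∀ {a a' a''}, ge₁ a a' → gt₁ a' a'' → gt₁ a a'') :
    WellFounded fun y x => lexGt gt₁ ge₁ gt₂ x y := by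
  have gt_of_ge_star {a a' a''} (h : ReflTransGen ge₁ a a') (h' : gt₁ a' a'') : gt₁ a a'' := by
    induction h using ReflTransGen.head_induction_on with
    | refl => exact h'
    | head hge _ ih => exact gt_of_ge_of_gt hge ih
  -- A descent in the second component may move the first one weakly down, so the outer
  -- induction has to treat all `a'` reachable from `a` at once.
  have acc (a b a') (h : ReflTransGen ge₁ a a') :
      Acc (fun y x => lexGt gt₁ ge₁ gt₂ x y) (a', b) := by
    induction a using wf₁.induction generalizing b a' with
    | _ a ih₁ =>
      induction b using wf₂.induction generalizing a' with
      | _ b ih₂ =>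
        refine ⟨_, ?_⟩
        rintro ⟨a'', b''⟩ (hgt | ⟨hge, hgt⟩)
        · exact ih₁ a'' (gt_of_ge_star h hgt) b'' a'' .refl
        · exact ih₂ b'' hgt a'' (h.tail hge)
  exact ⟨fun ⟨a, b⟩ => acc a b a .refl⟩

/-- `lexGt` and `lexGe` have the same definition, so with `r`, `s`, `t` among `gt₂` and `ge₂` this
covers every composition of the two. -/
theorem IsOrderPair.lexGt_of_lexGt_of_lexGt (h : IsOrderPair gt₁ ge₁) {r s t : B → B → Prop}
    (hrst : ∀ {β γ δ}, r β γ → s γ δ → t β δ) {x y z : A × B} (hxy : lexGt gt₁ ge₁ r x y)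
    (hyz : lexGt gt₁ ge₁ s y z) : lexGt gt₁ ge₁ t x z := by
  rcases hxy with hxy | ⟨hxy, hr⟩ <;> rcases hyz with hyz | ⟨hyz, hs⟩
  · exact .inl (h.gt_trans _ _ _ hxy hyz)
  · exact .inl (h.gt_of_gt_of_ge hxy hyz)
  · exact .inl (h.gt_of_ge_of_gt hxy hyz)
  · exact .inr ⟨h.ge_trans _ _ _ hxy hyz, hrst hr hs⟩

theorem IsOrderPair.lex {gt₂ ge₂ : B → B → Prop} (h₁ : IsOrderPair gt₁ ge₁)
    (h₂ : IsOrderPair gt₂ ge₂) : IsOrderPair (lexGt gt₁ ge₁ gt₂) (lexGe gt₁ ge₁ ge₂) where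
  wf := wellFounded_lexGt h₁.wf h₂.wf h₁.gt_of_ge_of_gt
  gt_trans _ _ _ := h₁.lexGt_of_lexGt_of_lexGt (h₂.gt_trans _ _ _)
  ge_refl _ := .inr ⟨h₁.ge_refl _, h₂.ge_refl _⟩
  ge_trans _ _ _ := h₁.lexGt_of_lexGt_of_lexGt (h₂.ge_trans _ _ _)
  compat _ _ _ _ hαβ hβγ hγδ := h₁.lexGt_of_lexGt_of_lexGt h₂.gt_of_gt_of_ge
    (h₁.lexGt_of_lexGt_of_lexGt h₂.gt_of_ge_of_gt hαβ hβγ) hγδ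

end LexicographicOrder

section SourceOrder

variable {L : FirstOrder.Language.{u, v}} {V : Type w} {R : System L V}

theorem dupRules_union_nonDupRules (R : System L V) : dupRules R ∪ nonDupRules R = R :=
  Set.inter_union_compl R {ρ | ρ.Duplicating}

theorem isOrderPair_src (hterm : RelTerminating (dupRules R) (nonDupRules R)) :
    IsOrderPair (srcGt R) (srcGe R) := by
  have h := hterm.isOrderPair
  rwa [dupRules_union_nonDupRules] at h

theorem srcGt_of_srcGt_of_srcGe {s t u : L.Term V} (h : srcGt R s t) (h' : srcGe R t u) :
    srcGt R s u :=
  transGen_relRewrites_of_reflTransGen_right h (by rwa [dupRules_union_nonDupRules])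

theorem Rule.duplicating_of_not_linearTerm_rhs {ρ : Rule L V} (hl : LinearTerm ρ.lhs)
    (hr : ¬ LinearTerm ρ.rhs) : ρ.Duplicating :=
  let ⟨x, hx⟩ := not_forall.1 hr
  ⟨x, (hl x).trans_lt (not_le.1 hx)⟩

theorem Step.rewrites (a : Step R) : Rewrites R a.source a.target :=
  ⟨a.redex, a.isStep⟩

theorem Step.srcGt_of_duplicating (a : Step R) (h : a.redex.rule.Duplicating) :
    srcGt R a.source a.target :=
  have hdup : Rewrites (dupRules R) a.source a.target :=
    ⟨a.redex, ⟨a.isStep.1, h⟩, a.isStep.2⟩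
  .single hdup.relRewrites

theorem IsConversion.srcGe_of_forall_isBwd {ds : List (DirStep R)} {v u : L.Term V}
    (h : IsConversion v ds u) (hds : ∀ d ∈ ds, d.IsBwd) : srcGe R u v := by
  induction ds generalizing v with
  | nil => exact h ▸ .refl
  | cons d ds ih =>
    obtain ⟨⟨a, rfl⟩, hbwd⟩ := List.forall_mem_cons.1 hds
    obtain ⟨rfl, htail⟩ := h
    exact .tail (ih htail hbwd) a.rewrites

theorem IsConversion.srcGe_source_of_forall_isBwd {ds : List (DirStep R)} {v u : L.Term V}
    (h : IsConversion v ds u) (hds : ∀ d ∈ ds, d.IsBwd) : ∀ d ∈ ds, srcGe R u d.step.source := by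
  induction ds generalizing v with
  | nil => exact List.forall_mem_nil _
  | cons d ds ih =>
    obtain ⟨⟨a, rfl⟩, hbwd⟩ := List.forall_mem_cons.1 hds
    exact List.forall_mem_cons.2 ⟨h.2.srcGe_of_forall_isBwd hbwd, ih h.2 hbwd⟩

end SourceOrder

section Labelings

variable {L : FirstOrder.Language.{u, v}} {V : Type w} {R : System L V}

theorem IsRewriteRelation.isLabeling_srcLabeling {gt ge : L.Term V → L.Term V → Prop}
    (hgt : IsRewriteRelation gt) (hge : IsRewriteRelation ge) :
    IsLabeling gt ge (srcLabeling R) where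
  gt_lift a b C σ := hgt C σ a.source b.source
  ge_lift a b C σ := hge C σ a.source b.source
  fwd_eq_bwd _ := rfl

theorem IsLabeling.lex {A B : Type*} {gt₁ ge₁ : A → A → Prop} {gt₂ ge₂ : B → B → Prop}
    {ℓ₁ : DirStep R → A} {ℓ₂ : DirStep R → B} (h₁ : IsLabeling gt₁ ge₁ ℓ₁)
    (h₂ : IsLabeling gt₂ ge₂ ℓ₂) :
    IsLabeling (lexGt gt₁ ge₁ gt₂) (lexGe gt₁ ge₁ ge₂) (fun d => (ℓ₁ d, ℓ₂ d)) where
  gt_lift a b C σ := Or.imp (h₁.gt_lift a b C σ)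
    (And.imp (h₁.ge_lift a b C σ) (h₂.gt_lift a b C σ))
  ge_lift a b C σ := Or.imp (h₁.gt_lift a b C σ)
    (And.imp (h₁.ge_lift a b C σ) (h₂.ge_lift a b C σ))
  fwd_eq_bwd a := Prod.ext (h₁.fwd_eq_bwd a) (h₂.fwd_eq_bwd a)

end Labelings

section Compatibility

variable {L : FirstOrder.Language.{u, v}} {V : Type w} {R : System L V} {A : Type z}
  {gt ge : A → A → Prop} {ℓ : DirStep R → A} {a b c : Step R}

theorem labels_nil_subset (S : Set A) : labels ℓ [] ⊆ S := by
  rintro _ ⟨_, hd, _⟩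
  exact absurd hd List.not_mem_nil

theorem labels_subset_below_singleton {r : A → A → Prop} {ds : List (DirStep R)} {α : A} :
    labels ℓ ds ⊆ below r {α} ↔ ∀ d ∈ ds, r α (ℓ d) := by
  simp only [labels, below, Set.subset_def, Set.mem_ofPred_eq, Set.mem_singleton_iff,
    exists_eq_left, forall_exists_index, and_imp, forall_apply_eq_imp_iff₂]

theorem extLocallyDecreasing_of_valley {u' : L.Term V} {d₂ c₃ : List (DirStep R)}
    (hc : c.source = a.target) (hcb : ge (ℓ (.fwd b)) (ℓ (.fwd c)))
    (hd₂ : IsConversion c.target d₂ u') (hlen : d₂.length ≤ 1) (hbwd : ∀ d ∈ d₂, d.IsBwd)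
    (hge : ∀ d ∈ d₂, ge (ℓ (.bwd a)) (ℓ d)) (hc₃ : IsConversion u' c₃ b.target)
    (hgt : ∀ d ∈ c₃, gt (ℓ (.fwd b)) (ℓ d)) : ExtLocallyDecreasing gt ge ℓ a b :=
  ⟨a.target, c.target, c.target, u', [], [.fwd c], [], d₂, c₃,
    ⟨rfl, labels_nil_subset _⟩,
    ⟨⟨hc, rfl⟩, le_rfl, List.forall_mem_singleton.2 ⟨c, rfl⟩,
      labels_subset_below_singleton.2 (List.forall_mem_singleton.2 hcb)⟩,
    ⟨rfl, labels_nil_subset _⟩,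
    ⟨hd₂, hlen, hbwd, labels_subset_below_singleton.2 hge⟩,
    ⟨hc₃, labels_subset_below_singleton.2 hgt⟩⟩

theorem WeakExtLocallyDecreasing.extLocallyDecreasing_srcLex
    (h : WeakExtLocallyDecreasing ge ℓ a b) (hpeak : IsPeak a b)
    (hlin : LinearTerm b.redex.rule.lhs) :
    ExtLocallyDecreasing (lexGt (srcGt R) (srcGe R) gt) (lexGe (srcGt R) (srcGe R) ge)
      (srcLex ℓ) a b := by
  obtain ⟨c, ds, hc, ⟨_, rfl, hcb⟩, hds, hbwd, hlabels, hlen⟩ := h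
  have hle : ∀ d ∈ ds, ge (ℓ (.bwd a)) (ℓ d) := labels_subset_below_singleton.1 hlabels
  have hsrc : ∀ d ∈ ds, srcGe R b.target d.step.source := hds.srcGe_source_of_forall_isBwd hbwd
  have hab : a.source = b.source := hpeak
  have hcb_src : srcGe R b.source c.source := hab ▸ hc ▸ .single a.rewrites
  by_cases hr : LinearTerm b.redex.rule.rhs
  · have ha_src (d) (hd : d ∈ ds) : srcGe R a.source d.step.source :=
      hab ▸ .head b.rewrites (hsrc d hd)
    exact extLocallyDecreasing_of_valley (c₃ := []) hc (.inr ⟨hcb_src, hcb⟩) hds (hlen hr) hbwd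
      (fun d hd => .inr ⟨ha_src d hd, hle d hd⟩) rfl (List.forall_mem_nil _)
  · have hb : srcGt R b.source b.target :=
      b.srcGt_of_duplicating (Rule.duplicating_of_not_linearTerm_rhs hlin hr)
    exact extLocallyDecreasing_of_valley (d₂ := []) hc (.inr ⟨hcb_src, hcb⟩) rfl (Nat.zero_le 1)
      (List.forall_mem_nil _) (List.forall_mem_nil _) hds
      (fun d hd => .inl (srcGt_of_srcGt_of_srcGe hb (hsrc d hd)))

theorem IsWeaklyCompatible.isCompatible_srcLex (h : IsWeaklyCompatible ge ℓ)
    (hleft : LeftLinear R) :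
    IsCompatible (lexGt (srcGt R) (srcGe R) gt) (lexGe (srcGt R) (srcGe R) ge) (srcLex ℓ) :=
  fun a b hab => (h a b hab).extLocallyDecreasing_srcLex (hab.elim And.left And.left)
    (hleft _ b.isStep.1)

end Compatibility

end TRS

theorem mainTheorem7 {L : FirstOrder.Language.{u, v}} {V : Type w} (R : TRS.System L V)
    (hleft : TRS.LeftLinear R)
    (hterm : TRS.RelTerminating (TRS.dupRules R) (TRS.nonDupRules R))
    {A : Type z} (gt ge : A → A → Prop) (ℓ : TRS.DirStep R → A)
    (hlab : TRS.IsLabeling gt ge ℓ) (hweak : TRS.IsWeaklyCompatible ge ℓ) :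
    TRS.IsLabeling
      (TRS.lexGt (TRS.srcGt R) (TRS.srcGe R) gt) (TRS.lexGe (TRS.srcGt R) (TRS.srcGe R) ge)
      (TRS.srcLex ℓ) ∧
    TRS.IsCompatible
      (TRS.lexGt (TRS.srcGt R) (TRS.srcGe R) gt) (TRS.lexGe (TRS.srcGt R) (TRS.srcGe R) ge)
      (TRS.srcLex ℓ) ∧
    (TRS.IsOrderPair gt ge →
      TRS.IsOrderPair
        (TRS.lexGt (TRS.srcGt R) (TRS.srcGe R) gt)
        (TRS.lexGe (TRS.srcGt R) (TRS.srcGe R) ge)) := by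
  refine ⟨?labeling, ?compatible, ?orderPair⟩
  case labeling =>
    exact ((TRS.isRewriteRelation_srcGt R).isLabeling_srcLabeling
      (TRS.isRewriteRelation_srcGe R)).lex hlab
  case compatible => exact hweak.isCompatible_srcLex hleft
  case orderPair => exact (TRS.isOrderPair_src hterm).lex
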